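/- **Lemma (Non-unitary oblivious fixed-point amplitude amplification).** There is an absolute constant $K>0$ such that the following holds for every $n\ge 0$, every $\Delta\in(0,1]$ and every $\delta\in(0,\tfrac12]$. There are a number $a\ge 0$ of ancilla qubits and a circuit on two control qubits, $n$ data qubits and the $a$ ancilla qubits, composed of fixed unitaries and of uses of two black-box unitaries $C$ (on the control and data qubits) and $S$ (on the data qubits) and of their inverses, such that the circuit, including its fixed unitaries, depends only on $n,\Delta,\delta$; it contains at most $\frac{K}{\Delta}\log\frac1\delta$ copies of $C$ and at most $\frac{K}{\Delta}\log\frac1\delta$ copies of $S$ (each use of an inverse counts as a copy); and it has the following property. Let $C$ be any unitary on $2+n$ qubits and $S$ any unitary on $n$ qubits such that $$C\,|00\rangle\, S|0^n\rangle=\sigma\,|00\rangle|\psi\rangle+|\Phi\rangle,\qquad (\langle 00|\otimes \mathbb 1)|\Phi\rangle=0,$$ for some unit vector $|\psi\rangle$ and some real $\sigma\ge\Delta$. Run the circuit on $|00\rangle|0^n\rangle|0^a\rangle$ and then measure the two control qubits. With probability at least $1-\delta$ the outcome is $00$, and after this outcome the control and data qubits are exactly in the state $|00\rangle|\psi\rangle$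 (up to a global phase), unentangled with the ancilla qubits. In particular, taking $\Delta=\sigma$, the state $|00\rangle|\psi\rangle$ is obtained with probability at least $1-\delta$ using $O\!\left(\frac1\sigma\log\frac1\delta\right)$ copies of $C$ and $S$. No unitarity (or near-unitarity) of a map taking $S|0^n\rangle$ to $|\psi\rangle$ is assumed. -/

import Mathlib

open scoped Matrix Kronecker

namespace QAmp

/-- Computational basis labels of `k` qubits; the label `0` is the all-zero string. -/
abbrev Qb (k : ℕ) : Type := Fin k → Fin 2

/-- The basis state `|0^k⟩`. -/
def ket0 (k : ℕ) : Qb k → ℂ := Pi.single 0 1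

/-- The product vector `u ⊗ v`. -/
def tensor {α β : Type*} (u : α → ℂ) (v : β → ℂ) : α × β → ℂ := fun p => u p.1 * v p.2

/-- Unit vectors for the Euclidean norm (pure states). -/
def IsState {α : Type*} [Fintype α] (v : α → ℂ) : Prop := ∑ x, ‖v x‖ ^ 2 = 1

/-- Labels of the whole workspace: two control qubits, `n` data qubits, `a` ancilla qubits. -/
abbrev Reg (n a : ℕ) : Type := (Qb 2 × Qb n) × Qb a

/-- The steps of a circuit with black boxes `C` (on control and data qubits) and `S` (on data
qubits). A step is one use of `C`, `C†`, `S` or `S†`, or a fixed unitary which does not depend on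
the black boxes. -/
inductive Gate (n a : ℕ) : Type
  | useC : Gate n a
  | useCDagger : Gate n a
  | useS : Gate n a
  | useSDagger : Gate n a
  | fixed (V : Matrix.unitaryGroup (Reg n a) ℂ) : Gate n a

variable {n a : ℕ}

/-- The operator on the workspace performed by a step, for given black boxes. -/
def Gate.op (C : Matrix.unitaryGroup (Qb 2 × Qb n) ℂ) (S : Matrix.unitaryGroup (Qb n) ℂ) :
    Gate n a → Matrix (Reg n a) (Reg n a) ℂ
  | .useC => (C : Matrix (Qb 2 × Qb n) (Qb 2 × Qb n) ℂ) ⊗ₖ (1 : Matrix (Qb a) (Qb a) ℂ)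
  | .useCDagger => (C : Matrix (Qb 2 × Qb n) (Qb 2 × Qb n) ℂ)ᴴ ⊗ₖ (1 : Matrix (Qb a) (Qb a) ℂ)
  | .useS => ((1 : Matrix (Qb 2) (Qb 2) ℂ) ⊗ₖ (S : Matrix (Qb n) (Qb n) ℂ)) ⊗ₖ
      (1 : Matrix (Qb a) (Qb a) ℂ)
  | .useSDagger => ((1 : Matrix (Qb 2) (Qb 2) ℂ) ⊗ₖ (S : Matrix (Qb n) (Qb n) ℂ)ᴴ) ⊗ₖ
      (1 : Matrix (Qb a) (Qb a) ℂ)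
  | .fixed V => (V : Matrix (Reg n a) (Reg n a) ℂ)

/-- Number of copies of `C` in a step; an inverse counts as a copy. -/
def Gate.copiesC : Gate n a → ℕ
  | .useC => 1
  | .useCDagger => 1
  | _ => 0

/-- Number of copies of `S` in a step; an inverse counts as a copy. -/
def Gate.copiesS : Gate n a → ℕ
  | .useS => 1
  | .useSDagger => 1
  | _ => 0

/-- A circuit: the list of its steps, the first element being applied first. -/
abbrev Circuit (n a : ℕ) : Type := List (Gate n a)

/-- Total number of copies of `C` in a circuit. -/
def Circuit.copiesC (c : Circuit n a) : ℕ := (c.map Gate.copiesC).sum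

/-- Total number of copies of `S` in a circuit. -/
def Circuit.copiesS (c : Circuit n a) : ℕ := (c.map Gate.copiesS).sum

/-- The state produced from `v` by a circuit, for given black boxes. -/
def Circuit.run (C : Matrix.unitaryGroup (Qb 2 × Qb n) ℂ) (S : Matrix.unitaryGroup (Qb n) ℂ)
    (c : Circuit n a) (v : Reg n a → ℂ) : Reg n a → ℂ :=
  c.foldl (fun w g => g.op C S *ᵥ w) v

/-- The projection of a workspace vector onto control value `00`, i.e. `(|00⟩⟨00| ⊗ 1 ⊗ 1) v`. -/
def projControl (v : Reg n a → ℂ) : Reg n a → ℂ := fun r => if r.1.1 = 0 then v r else 0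

/-- Measuring the two control qubits of `v` yields `00` with probability at least `p`, and after
this outcome the control and data qubits are exactly in the state `|00⟩|ψ⟩`, unentangled with the
ancilla qubits. -/
def Obtains (v : Reg n a → ℂ) (ψ : Qb n → ℂ) (p : ℝ) : Prop :=
  p ≤ ∑ r, ‖projControl v r‖ ^ 2 ∧
    ∃ χ : Qb a → ℂ, projControl v = tensor (tensor (ket0 2) ψ) χ

end QAmp

namespace QAmp

open Matrix

variable {n a : ℕ}

/-! Nest a three-fold amplification: from a circuit `U` with output `u`, apply `U`, a phase on
control value `00`, `U†`, a phase on the initial basis state, and `U`. The result stays in the span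
of `u` and its `00` part, so the `00` part is only rescaled (`projControl_amplify`). This is why `ψ`
comes out exactly, whatever the black boxes are. With common phase `e`, `Re e = x`, the failure
probability `y` becomes `y * ((2x-1) + (2-2x)y)^2` (`failProb_amplify`). Taking `x = phaseCos g`
turns this, for `Y = g^2 y`, into `Y(4Y-3)^2 = T₃(√Y)^2`, rescaled by `T₃(g)^2`, with `T₃` the
Chebyshev polynomial. Since `T₃(cosh t) = cosh 3t`, the bound `cosh(3^k Δ)^2 * y ≤ 1` persists
through the rounds, at a cost of `3^k` copies. As `cosh` grows exponentially, `3^k` of order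
`log(1/δ)/Δ` suffices. -/

/-- The inverse step. -/
def Gate.inv : Gate n a → Gate n a
  | .useC => .useCDagger
  | .useCDagger => .useC
  | .useS => .useSDagger
  | .useSDagger => .useS
  | .fixed V => .fixed V⁻¹

/-- The inverse circuit. -/
def Circuit.inv (c : Circuit n a) : Circuit n a := (c.map Gate.inv).reverse

/-- The matrix of a circuit. -/
def Circuit.mat (C : unitaryGroup (Qb 2 × Qb n) ℂ) (S : unitaryGroup (Qb n) ℂ) :
    Circuit n a → Matrix (Reg n a) (Reg n a) ℂ
  | [] => 1
  | g :: c => Circuit.mat C S c * g.op C S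

section Operators

variable (C : unitaryGroup (Qb 2 × Qb n) ℂ) (S : unitaryGroup (Qb n) ℂ)

lemma Circuit.run_eq (c : Circuit n a) (v : Reg n a → ℂ) : c.run C S v = c.mat C S *ᵥ v := by
  induction c generalizing v with
  | nil => simp [Circuit.run, Circuit.mat]
  | cons g c ih =>
    rw [Circuit.mat, ← mulVec_mulVec, ← ih]
    rfl

lemma Circuit.mat_append (c d : Circuit n a) :
    Circuit.mat C S (c ++ d) = d.mat C S * c.mat C S := by
  induction c with
  | nil => simp [Circuit.mat]
  | cons g c ih => simp only [List.cons_append, Circuit.mat, ih, Matrix.mul_assoc]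

lemma Gate.op_inv (g : Gate n a) : g.inv.op C S = (g.op C S)ᴴ := by
  cases g <;> simp [Gate.inv, Gate.op, conjTranspose_kronecker, star_eq_conjTranspose]

lemma Circuit.mat_inv (c : Circuit n a) : c.inv.mat C S = (c.mat C S)ᴴ := by
  induction c with
  | nil => simp [Circuit.inv, Circuit.mat]
  | cons g c ih =>
    have h : Circuit.inv (g :: c) = Circuit.inv c ++ [g.inv] := by simp [Circuit.inv]
    rw [h, Circuit.mat_append, ih]
    simp [Circuit.mat, Gate.op_inv, conjTranspose_mul]

lemma Gate.op_mem (g : Gate n a) : g.op C S ∈ unitaryGroup (Reg n a) ℂ := by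
  have hC := C.2
  have hS := S.2
  have hC' : (C : Matrix (Qb 2 × Qb n) (Qb 2 × Qb n) ℂ)ᴴ ∈ unitaryGroup (Qb 2 × Qb n) ℂ :=
    Unitary.star_mem hC
  have hS' : (S : Matrix (Qb n) (Qb n) ℂ)ᴴ ∈ unitaryGroup (Qb n) ℂ := Unitary.star_mem hS
  cases g with
  | useC => exact kronecker_mem_unitary hC (one_mem _)
  | useCDagger => exact kronecker_mem_unitary hC' (one_mem _)
  | useS => exact kronecker_mem_unitary (kronecker_mem_unitary (one_mem _) hS) (one_mem _)
  | useSDagger => exact kronecker_mem_unitary (kronecker_mem_unitary (one_mem _) hS') (one_mem _)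
  | fixed V => exact V.2

lemma Circuit.mat_mem (c : Circuit n a) : c.mat C S ∈ unitaryGroup (Reg n a) ℂ := by
  induction c with
  | nil => exact one_mem _
  | cons g c ih => exact mul_mem ih (g.op_mem C S)

end Operators

section Copies

lemma Circuit.copiesC_append (c d : Circuit n a) :
    Circuit.copiesC (c ++ d) = c.copiesC + d.copiesC := by
  simp [Circuit.copiesC]

lemma Circuit.copiesS_append (c d : Circuit n a) :
    Circuit.copiesS (c ++ d) = c.copiesS + d.copiesS := by
  simp [Circuit.copiesS]

lemma Circuit.copiesC_inv (c : Circuit n a) : c.inv.copiesC = c.copiesC := by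
  have h : (Gate.copiesC ∘ Gate.inv : Gate n a → ℕ) = Gate.copiesC := by
    funext g; cases g <;> rfl
  simp [Circuit.copiesC, Circuit.inv, List.sum_reverse, h]

lemma Circuit.copiesS_inv (c : Circuit n a) : c.inv.copiesS = c.copiesS := by
  have h : (Gate.copiesS ∘ Gate.inv : Gate n a → ℕ) = Gate.copiesS := by
    funext g; cases g <;> rfl
  simp [Circuit.copiesS, Circuit.inv, List.sum_reverse, h]

end Copies

/-! ### One amplification round -/

/-- The diagonal unitary multiplying the basis states selected by `p` by the phase `e`. -/
def phaseGate (e : Circle) (p : Reg n a → Prop) [DecidablePred p] : unitaryGroup (Reg n a) ℂ :=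
  ⟨diagonal fun r => if p r then (e : ℂ) else 1, by
    rw [mem_unitaryGroup_iff, star_eq_conjTranspose, diagonal_conjTranspose, diagonal_mul_diagonal,
      ← diagonal_one]
    congr 1
    funext r
    by_cases h : p r <;> simp [h, Complex.mul_conj]⟩

lemma phaseGate_mulVec (e : Circle) (p : Reg n a → Prop) [DecidablePred p] (v : Reg n a → ℂ) :
    (phaseGate e p : Matrix (Reg n a) (Reg n a) ℂ) *ᵥ v
      = v - (1 - (e : ℂ)) • fun r => if p r then v r else 0 := by
  funext r
  simp only [phaseGate, mulVec_diagonal, Pi.sub_apply, Pi.smul_apply, smul_eq_mul]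
  split_ifs <;> ring

/-- One round of three-fold amplification of a circuit `c`, with phase `e`. -/
def amplify (e : Circle) (c : Circuit n a) : Circuit n a :=
  c ++ (Gate.fixed (phaseGate e fun r => r.1.1 = 0) :: c.inv) ++
    (Gate.fixed (phaseGate e fun r => r = 0) :: c)

lemma copiesC_amplify (e : Circle) (c : Circuit n a) :
    (amplify e c).copiesC = 3 * c.copiesC := by
  have h (V : unitaryGroup (Reg n a) ℂ) (d : Circuit n a) :
      Circuit.copiesC (Gate.fixed V :: d) = d.copiesC := by simp [Circuit.copiesC, Gate.copiesC]
  rw [amplify, Circuit.copiesC_append, Circuit.copiesC_append, h, h, Circuit.copiesC_inv]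
  ring

lemma copiesS_amplify (e : Circle) (c : Circuit n a) :
    (amplify e c).copiesS = 3 * c.copiesS := by
  have h (V : unitaryGroup (Reg n a) ℂ) (d : Circuit n a) :
      Circuit.copiesS (Gate.fixed V :: d) = d.copiesS := by simp [Circuit.copiesS, Gate.copiesS]
  rw [amplify, Circuit.copiesS_append, Circuit.copiesS_append, h, h, Circuit.copiesS_inv]
  ring

/-- The all-zero basis state of the workspace. -/
def start (n a : ℕ) : Reg n a → ℂ := Pi.single 0 1

lemma tensor_ket0 (n a : ℕ) : tensor (tensor (ket0 2) (ket0 n)) (ket0 a) = start n a := by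
  funext r
  obtain ⟨⟨x, y⟩, z⟩ := r
  have h : (((x, y), z) : Reg n a) = 0 ↔ (x = 0 ∧ y = 0) ∧ z = 0 := by simp [Prod.ext_iff]
  simp only [tensor, ket0, start, Pi.single_apply, h]
  by_cases hx : x = 0 <;> by_cases hy : y = 0 <;> by_cases hz : z = 0 <;> simp [hx, hy, hz]

section Amplify

variable (C : unitaryGroup (Qb 2 × Qb n) ℂ) (S : unitaryGroup (Qb n) ℂ)

lemma dotProduct_run_start (c : Circuit n a) :
    star (c.run C S (start n a)) ⬝ᵥ c.run C S (start n a) = 1 := by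
  have h : (c.mat C S)ᴴ * c.mat C S = 1 := mem_unitaryGroup_iff'.1 (c.mat_mem C S)
  rw [Circuit.run_eq, star_mulVec, ← dotProduct_mulVec, mulVec_mulVec, h, one_mulVec]
  simp [start]

/-- Conjugating the phase on the initial state by the circuit gives the rank-one update `v ↦ v - (1
- e)⟨u, v⟩u`. -/
lemma run_amplify (e : Circle) (c : Circuit n a) (u : Reg n a → ℂ)
    (hu : u = c.run C S (start n a)) :
    (amplify e c).run C S (start n a)
      = (u - (1 - (e : ℂ)) • projControl u)
        - ((1 - (e : ℂ)) * (star u ⬝ᵥ (u - (1 - (e : ℂ)) • projControl u))) • u := by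
  have h : c.mat C S * (c.mat C S)ᴴ = 1 := mem_unitaryGroup_iff.1 (c.mat_mem C S)
  rw [Circuit.run_eq] at hu
  set v := u - (1 - (e : ℂ)) • projControl u with hv
  have hp : (phaseGate e (fun r : Reg n a => r.1.1 = 0) : Matrix (Reg n a) (Reg n a) ℂ) *ᵥ u = v :=
    phaseGate_mulVec e _ u
  have h0 (w : Reg n a → ℂ) : (fun r => if r = 0 then w r else 0) = w 0 • start n a := by
    funext r
    by_cases hr : r = 0 <;> simp [start, hr]
  have hin : ((c.mat C S)ᴴ *ᵥ v) 0 = star u ⬝ᵥ v := by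
    rw [hu, star_mulVec, ← dotProduct_mulVec]
    simp [start]
  rw [Circuit.run_eq, amplify, Circuit.mat_append, Circuit.mat_append]
  simp only [Circuit.mat, Circuit.mat_inv, Gate.op, ← mulVec_mulVec]
  rw [← hu, hp, phaseGate_mulVec, h0, mulVec_sub, mulVec_mulVec, h, one_mulVec, mulVec_smul,
    mulVec_smul, ← hu, hin, smul_smul]

end Amplify

/-! ### Failure probability and its change in one round -/

/-- The probability that measuring the control qubits does not yield `00`. -/
noncomputable def failProb (v : Reg n a → ℂ) : ℝ := ∑ r, ‖v r - projControl v r‖ ^ 2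

lemma failProb_nonneg (v : Reg n a → ℂ) : 0 ≤ failProb v :=
  Finset.sum_nonneg fun _ _ => sq_nonneg _

lemma star_dotProduct_projControl (v : Reg n a → ℂ) :
    star v ⬝ᵥ projControl v = ((∑ r, ‖projControl v r‖ ^ 2 : ℝ) : ℂ) := by
  push_cast
  refine Finset.sum_congr rfl fun r _ => ?_
  simp only [projControl, Pi.star_apply]
  split_ifs
  · exact Complex.conj_mul' _
  · simp

lemma sum_projControl (v : Reg n a → ℂ) (hv : star v ⬝ᵥ v = 1) :
    ∑ r, ‖projControl v r‖ ^ 2 = 1 - failProb v := by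
  have h : ∑ r, ‖v r‖ ^ 2 = 1 := by
    have : ((∑ r, ‖v r‖ ^ 2 : ℝ) : ℂ) = 1 := by
      rw [← hv]
      push_cast
      exact Finset.sum_congr rfl fun r _ => (Complex.conj_mul' _).symm
    exact_mod_cast this
  rw [← h, failProb, ← Finset.sum_sub_distrib]
  refine Finset.sum_congr rfl fun r _ => ?_
  simp only [projControl]
  split_ifs <;> simp

lemma projControl_sub (v w : Reg n a → ℂ) :
    projControl (v - w) = projControl v - projControl w := by
  funext r
  simp only [projControl, Pi.sub_apply]
  split_ifs <;> simp

lemma projControl_smul (z : ℂ) (v : Reg n a → ℂ) :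
    projControl (z • v) = z • projControl v := by
  funext r
  simp only [projControl, Pi.smul_apply]
  split_ifs <;> simp

lemma projControl_projControl (v : Reg n a → ℂ) :
    projControl (projControl v) = projControl v := by
  funext r
  simp only [projControl]
  split_ifs <;> rfl

/-- The phase `e` with real part `c`, for `c` in `[-1, 1]`. -/
noncomputable def phase (c : ℝ) : Circle := Circle.exp (Real.arccos c)

lemma phase_sq (c : ℝ) (h₁ : -1 ≤ c) (h₂ : c ≤ 1) :
    (phase c : ℂ) ^ 2 + 1 = 2 * c * phase c := by
  have h : (phase c : ℂ) = c + Real.sin (Real.arccos c) * Complex.I := by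
    rw [phase, Circle.coe_exp, Complex.exp_mul_I, ← Complex.ofReal_cos, ← Complex.ofReal_sin,
      Real.cos_arccos h₁ h₂]
  have hs : ((Real.sin (Real.arccos c) : ℝ) : ℂ) ^ 2 + (c : ℂ) ^ 2 = 1 := by
    have := Real.sin_sq_add_cos_sq (Real.arccos c)
    rw [Real.cos_arccos h₁ h₂] at this
    exact_mod_cast this
  rw [h]
  linear_combination
    ((Real.sin (Real.arccos c) : ℝ) : ℂ) ^ 2 * Complex.I_sq - hs

section Round

variable (C : unitaryGroup (Qb 2 × Qb n) ℂ) (S : unitaryGroup (Qb n) ℂ)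

lemma projControl_amplify (e : Circle) (c : Circuit n a) :
    ∃ z : ℂ, projControl ((amplify e c).run C S (start n a))
      = z • projControl (c.run C S (start n a)) := by
  rw [run_amplify C S e c _ rfl]
  set u := c.run C S (start n a)
  set w := star u ⬝ᵥ (u - (1 - (e : ℂ)) • projControl u)
  refine ⟨e - (1 - (e : ℂ)) * w, ?_⟩
  simp only [projControl_sub, projControl_smul, projControl_projControl]
  module

lemma failProb_amplify (x : ℝ) (h₁ : -1 ≤ x) (h₂ : x ≤ 1) (c : Circuit n a) :
    failProb ((amplify (phase x) c).run C S (start n a))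
      = failProb (c.run C S (start n a)) *
        ((2 * x - 1) + (2 - 2 * x) * failProb (c.run C S (start n a))) ^ 2 := by
  rw [run_amplify C S _ c _ rfl]
  have hn := dotProduct_run_start C S c
  set u := c.run C S (start n a)
  set y := failProb u with hy
  set e : ℂ := (phase x : ℂ) with he
  have hw : star u ⬝ᵥ (u - (1 - e) • projControl u) = 1 - (1 - e) * (1 - y) := by
    rw [dotProduct_sub, dotProduct_smul, hn, star_dotProduct_projControl, sum_projControl u hn]
    simp [hy]
  rw [hw]
  have hsq := phase_sq x h₁ h₂
  rw [← he] at hsq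
  -- The relation `e^2 + 1 = 2xe` makes the multiplier of the failing component a real number times
  -- `e`, so its modulus is explicit.
  have hcoef : 1 - (1 - e) * (1 - (1 - e) * (1 - y))
      = e * (((2 * x - 1) + (2 - 2 * x) * y : ℝ) : ℂ) := by
    push_cast
    linear_combination (1 - y : ℂ) * hsq
  have hr (r : Reg n a) :
      (u - (1 - e) • projControl u - ((1 - e) * (1 - (1 - e) * (1 - y))) • u) r
        - projControl (u - (1 - e) • projControl u - ((1 - e) * (1 - (1 - e) * (1 - y))) • u) r
        = e * (((2 * x - 1) + (2 - 2 * x) * y : ℝ) : ℂ) * (u r - projControl u r) := by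
    simp only [projControl_sub, projControl_smul, projControl_projControl, Pi.sub_apply,
      Pi.smul_apply, smul_eq_mul]
    rw [← hcoef]
    ring
  have hnorm : ‖e‖ = 1 := Circle.norm_coe _
  have hsum (q : ℝ) : y * q = ∑ r, q * ‖u r - projControl u r‖ ^ 2 := by
    rw [mul_comm, hy, failProb, Finset.mul_sum]
  rw [hsum, failProb]
  refine Finset.sum_congr rfl fun r _ => ?_
  rw [hr, norm_mul, norm_mul, hnorm, one_mul, mul_pow, Complex.norm_real, Real.norm_eq_abs, sq_abs]

end Round

/-! ### Choice of phases and the Chebyshev recursion -/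

/-- The real part of the phase used when the scaled failure amplitude has scale `g`. -/
noncomputable def phaseCos (g : ℝ) : ℝ := (2 * g ^ 2 - 3) / (4 * g ^ 2 - 3)

/-- The circuit after `k` nested rounds, tuned to the lower bound `Δ` of the amplitude. -/
noncomputable def fixedPoint (n : ℕ) (Δ : ℝ) : ℕ → Circuit n 0
  | 0 => [.useS, .useC]
  | k + 1 => amplify (phase (phaseCos (Real.cosh (3 ^ k * Δ)))) (fixedPoint n Δ k)

lemma copiesC_fixedPoint (n : ℕ) (Δ : ℝ) (k : ℕ) : (fixedPoint n Δ k).copiesC = 3 ^ k := by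
  induction k with
  | zero => rfl
  | succ k ih => rw [fixedPoint, copiesC_amplify, ih, pow_succ']

lemma copiesS_fixedPoint (n : ℕ) (Δ : ℝ) (k : ℕ) : (fixedPoint n Δ k).copiesS = 3 ^ k := by
  induction k with
  | zero => rfl
  | succ k ih => rw [fixedPoint, copiesS_amplify, ih, pow_succ']

/-- The left side equals `Y(4Y-3)^2` with `Y = g^2 y`, and `1 - Y(4Y-3)^2 = (1-Y)(1-4Y)^2`. -/
lemma scaled_round_le_one {g y : ℝ} (hg : 1 ≤ g) (hy : 0 ≤ y) (h : g ^ 2 * y ≤ 1) :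
    (4 * g ^ 3 - 3 * g) ^ 2 *
      (y * ((2 * phaseCos g - 1) + (2 - 2 * phaseCos g) * y) ^ 2) ≤ 1 := by
  have hd : 0 < 4 * g ^ 2 - 3 := by nlinarith
  have hk : (4 * g ^ 2 - 3) * ((2 * phaseCos g - 1) + (2 - 2 * phaseCos g) * y)
      = 4 * (g ^ 2 * y) - 3 := by
    have : (4 * g ^ 2 - 3) * phaseCos g = 2 * g ^ 2 - 3 := mul_div_cancel₀ _ hd.ne'
    linear_combination (2 - 2 * y) * this
  have hY : 0 ≤ g ^ 2 * y := by positivity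
  calc _ = g ^ 2 * y *
        ((4 * g ^ 2 - 3) * ((2 * phaseCos g - 1) + (2 - 2 * phaseCos g) * y)) ^ 2 := by ring
    _ = 1 - (1 - g ^ 2 * y) * (1 - 4 * (g ^ 2 * y)) ^ 2 := by rw [hk]; ring
    _ ≤ 1 := sub_le_self _ (mul_nonneg (sub_nonneg.2 h) (sq_nonneg _))

lemma phaseCos_mem {g : ℝ} (hg : 1 ≤ g) : -1 ≤ phaseCos g ∧ phaseCos g ≤ 1 := by
  have hd : 0 < 4 * g ^ 2 - 3 := by nlinarith
  constructor
  · rw [phaseCos, le_div_iff₀ hd]; nlinarith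
  · rw [phaseCos, div_le_one hd]; nlinarith

/-! ### Correctness of the nested circuit -/

section Correctness

variable (C : unitaryGroup (Qb 2 × Qb n) ℂ) (S : unitaryGroup (Qb n) ℂ)

lemma failProb_fixedPoint {Δ : ℝ}
    (h0 : failProb ((fixedPoint n Δ 0).run C S (start n 0)) ≤ 1 - Δ ^ 2) (k : ℕ) :
    Real.cosh (3 ^ k * Δ) ^ 2 * failProb ((fixedPoint n Δ k).run C S (start n 0)) ≤ 1 := by
  induction k with
  | zero =>
    -- Base case: `cosh(Δ)^2 * (1 - Δ^2) ≤ exp(Δ^2) * exp(-Δ^2) = 1`.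
    have h1 : Real.cosh Δ ^ 2 ≤ Real.exp (Δ ^ 2) := by
      calc Real.cosh Δ ^ 2 ≤ Real.exp (Δ ^ 2 / 2) ^ 2 :=
            pow_le_pow_left₀ (Real.cosh_pos _).le (Real.cosh_le_exp_half_sq _) 2
        _ = Real.exp (Δ ^ 2) := by rw [← Real.exp_nat_mul]; congr 1; push_cast; ring
    have h2 : 1 - Δ ^ 2 ≤ Real.exp (-Δ ^ 2) := by
      have := Real.add_one_le_exp (-Δ ^ 2); linarith
    rw [pow_zero, one_mul]
    calc _ ≤ Real.exp (Δ ^ 2) * Real.exp (-Δ ^ 2) :=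
          mul_le_mul h1 (h0.trans h2) (failProb_nonneg _) (Real.exp_pos _).le
      _ = 1 := by rw [← Real.exp_add]; simp
  | succ k ih =>
    have hg := Real.one_le_cosh (3 ^ k * Δ)
    have h3 : Real.cosh (3 ^ (k + 1) * Δ)
        = 4 * Real.cosh (3 ^ k * Δ) ^ 3 - 3 * Real.cosh (3 ^ k * Δ) := by
      rw [← Real.cosh_three_mul]; congr 1; ring
    rw [fixedPoint, failProb_amplify C S _ (phaseCos_mem hg).1 (phaseCos_mem hg).2, h3]
    exact scaled_round_le_one hg (failProb_nonneg _) ih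

lemma projControl_fixedPoint (Δ : ℝ) (k : ℕ) :
    ∃ z : ℂ, projControl ((fixedPoint n Δ k).run C S (start n 0))
      = z • projControl ((fixedPoint n Δ 0).run C S (start n 0)) := by
  induction k with
  | zero => exact ⟨1, (one_smul _ _).symm⟩
  | succ k ih =>
    obtain ⟨z, hz⟩ := ih
    obtain ⟨z', hz'⟩ := projControl_amplify C S
      (phase (phaseCos (Real.cosh (3 ^ k * Δ)))) (fixedPoint n Δ k)
    exact ⟨z' * z, hz'.trans (by rw [hz, smul_smul])⟩

lemma kronecker_mulVec_tensor {α β : Type*} [Fintype α] [Fintype β] (A : Matrix α α ℂ)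
    (B : Matrix β β ℂ) (u : α → ℂ) (v : β → ℂ) :
    (A ⊗ₖ B) *ᵥ tensor u v = tensor (A *ᵥ u) (B *ᵥ v) := by
  funext p
  simp only [mulVec, dotProduct, tensor, kroneckerMap_apply, Fintype.sum_prod_type,
    Finset.sum_mul_sum]
  exact Finset.sum_congr rfl fun i _ => Finset.sum_congr rfl fun j _ => by ring

lemma run_fixedPoint_zero (Δ : ℝ) :
    (fixedPoint n Δ 0).run C S (start n 0)
      = tensor ((C : Matrix (Qb 2 × Qb n) (Qb 2 × Qb n) ℂ) *ᵥ
          tensor (ket0 2) ((S : Matrix (Qb n) (Qb n) ℂ) *ᵥ ket0 n)) (ket0 0) := by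
  rw [← tensor_ket0]
  simp [fixedPoint, Circuit.run, Gate.op, kronecker_mulVec_tensor]

lemma projControl_tensor {σ : ℝ} {ψ : Qb n → ℂ} {Φ : Qb 2 × Qb n → ℂ}
    (hΦ : ∀ x : Qb n, Φ (0, x) = 0) (χ : Qb a → ℂ) :
    projControl (tensor ((σ : ℂ) • tensor (ket0 2) ψ + Φ) χ)
      = (σ : ℂ) • tensor (tensor (ket0 2) ψ) χ := by
  funext r
  obtain ⟨⟨x, y⟩, z⟩ := r
  by_cases hx : x = 0
  · subst hx
    simp [projControl, tensor, hΦ, mul_assoc]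
  · simp [projControl, tensor, ket0, hx]

lemma sum_norm_tensor {α β : Type*} [Fintype α] [Fintype β] (u : α → ℂ) (v : β → ℂ) :
    ∑ p, ‖tensor u v p‖ ^ 2 = (∑ x, ‖u x‖ ^ 2) * ∑ y, ‖v y‖ ^ 2 := by
  simp only [tensor, Fintype.sum_prod_type, Finset.sum_mul_sum, norm_mul, mul_pow]

lemma sum_norm_ket0 (k : ℕ) : ∑ x, ‖ket0 k x‖ ^ 2 = 1 := by
  rw [Finset.sum_eq_single 0] <;> simp +contextual [ket0]

lemma fixedPoint_obtains {Δ δ σ : ℝ} {ψ : Qb n → ℂ} {Φ : Qb 2 × Qb n → ℂ} (k : ℕ) (hΔ : 0 < Δ)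
    (hk : 1 / δ ≤ Real.cosh (3 ^ k * Δ) ^ 2) (hδ : 0 < δ) (hσ : Δ ≤ σ) (hψ : IsState ψ)
    (hC : (C : Matrix (Qb 2 × Qb n) (Qb 2 × Qb n) ℂ) *ᵥ
        tensor (ket0 2) ((S : Matrix (Qb n) (Qb n) ℂ) *ᵥ ket0 n)
      = (σ : ℂ) • tensor (ket0 2) ψ + Φ)
    (hΦ : ∀ x : Qb n, Φ (0, x) = 0) :
    Obtains ((fixedPoint n Δ k).run C S (start n 0)) ψ (1 - δ) := by
  have hp0 : projControl ((fixedPoint n Δ 0).run C S (start n 0))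
      = (σ : ℂ) • tensor (tensor (ket0 2) ψ) (ket0 0) := by
    rw [run_fixedPoint_zero, hC, projControl_tensor hΦ]
  have hs : ∑ r, ‖projControl ((fixedPoint n Δ 0).run C S (start n 0)) r‖ ^ 2 = σ ^ 2 := by
    simp only [hp0, Pi.smul_apply, smul_eq_mul, norm_mul, mul_pow, ← Finset.mul_sum,
      sum_norm_tensor, sum_norm_ket0, Complex.norm_real, Real.norm_eq_abs, sq_abs]
    rw [hψ]
    ring
  have h0 : failProb ((fixedPoint n Δ 0).run C S (start n 0)) ≤ 1 - Δ ^ 2 := by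
    rw [sum_projControl _ (dotProduct_run_start C S _)] at hs
    nlinarith
  have hf := failProb_fixedPoint C S h0 k
  constructor
  · rw [sum_projControl _ (dotProduct_run_start C S _)]
    have h1 : 1 / δ * failProb ((fixedPoint n Δ k).run C S (start n 0)) ≤ 1 :=
      (mul_le_mul_of_nonneg_right hk (failProb_nonneg _)).trans hf
    rw [one_div, inv_mul_le_iff₀ hδ] at h1
    linarith
  · obtain ⟨z, hz⟩ := projControl_fixedPoint C S Δ k
    -- With no ancilla qubits, the ancilla factor just carries the scalar accumulated over the
    -- rounds.
    refine ⟨(z * σ) • ket0 0, ?_⟩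
    rw [hz, hp0, smul_smul]
    funext r
    simp only [tensor, Pi.smul_apply, smul_eq_mul]
    ring

end Correctness

/-! ### Number of rounds -/

/-- The number of rounds: `3 ^ k` is of order `log (1 / δ) / Δ`. -/
lemma exists_rounds {Δ δ : ℝ} (hΔ : 0 < Δ) (hΔ1 : Δ ≤ 1) (hδ : 0 < δ) (hδ2 : δ ≤ 1 / 2) :
    ∃ k : ℕ, (3 : ℝ) ^ k ≤ 9 / 2 * (1 / Δ * Real.log (1 / δ)) ∧
      1 / δ ≤ Real.cosh (3 ^ k * Δ) ^ 2 := by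
  set L := Real.log (1 / δ) with hL
  have hL2 : Real.log 2 ≤ L :=
    Real.log_le_log two_pos ((le_div_iff₀ hδ).2 (by linarith))
  have hlog := Real.log_two_gt_d9
  -- The factor `3/2` serves twice: `3/2 * log 2 > 1` here, and `2t ≥ 3L ≥ 2 log 2 + L` in `hexp`.
  have hX : 1 ≤ 3 / 2 * (1 / Δ * L) := by
    have : L ≤ 1 / Δ * L := le_mul_of_one_le_left (by linarith) ((one_le_div hΔ).2 hΔ1)
    linarith
  obtain ⟨k, hk1, hk2⟩ := exists_nat_pow_near hX (by norm_num : (1 : ℝ) < 3)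
  -- Rounding up to the next power of 3 costs a factor 3, whence `9/2`.
  refine ⟨k + 1, by rw [pow_succ]; linarith, ?_⟩
  set t : ℝ := 3 ^ (k + 1) * Δ
  have ht : 3 / 2 * L ≤ t := by
    have := mul_le_mul_of_nonneg_right hk2.le hΔ.le
    have h' : 3 / 2 * (1 / Δ * L) * Δ = 3 / 2 * L := by field_simp
    linarith
  have hcosh : Real.exp t / 2 ≤ Real.cosh t := by
    rw [Real.cosh_eq]; have := Real.exp_pos (-t); linarith
  have hexp : 4 * (1 / δ) ≤ Real.exp t ^ 2 := by
    rw [← Real.exp_nat_mul]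
    calc 4 * (1 / δ) = Real.exp (2 * Real.log 2 + L) := by
          rw [Real.exp_add, hL, Real.exp_log (by positivity), mul_comm 2, Real.exp_mul,
            Real.exp_log two_pos]
          norm_num
      _ ≤ Real.exp ((2 : ℕ) * t) := Real.exp_le_exp.2 (by push_cast; linarith)
  have := pow_le_pow_left₀ (by positivity) hcosh 2
  linarith [div_pow (Real.exp t) 2 2]

end QAmp

theorem mainTheorem2 :
    ∃ K : ℝ, 0 < K ∧
      ∀ (n : ℕ) (Δ δ : ℝ), 0 < Δ → Δ ≤ 1 → 0 < δ → δ ≤ 1 / 2 →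
        ∃ (a : ℕ) (circ : QAmp.Circuit n a),
          (circ.copiesC : ℝ) ≤ K * (1 / Δ * Real.log (1 / δ)) ∧
          (circ.copiesS : ℝ) ≤ K * (1 / Δ * Real.log (1 / δ)) ∧
          ∀ (C : Matrix.unitaryGroup (QAmp.Qb 2 × QAmp.Qb n) ℂ)
            (S : Matrix.unitaryGroup (QAmp.Qb n) ℂ)
            (σ : ℝ) (ψ : QAmp.Qb n → ℂ) (Φ : QAmp.Qb 2 × QAmp.Qb n → ℂ),
            Δ ≤ σ → QAmp.IsState ψ →
            (C : Matrix (QAmp.Qb 2 × QAmp.Qb n) (QAmp.Qb 2 × QAmp.Qb n) ℂ) *ᵥ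
                QAmp.tensor (QAmp.ket0 2)
                  ((S : Matrix (QAmp.Qb n) (QAmp.Qb n) ℂ) *ᵥ QAmp.ket0 n)
              = (σ : ℂ) • QAmp.tensor (QAmp.ket0 2) ψ + Φ →
            (∀ x : QAmp.Qb n, Φ (0, x) = 0) →
            QAmp.Obtains
              (circ.run C S
                (QAmp.tensor (QAmp.tensor (QAmp.ket0 2) (QAmp.ket0 n)) (QAmp.ket0 a)))
              ψ (1 - δ) := by
  refine ⟨9 / 2, by norm_num, fun n Δ δ hΔ hΔ1 hδ hδ2 => ?_⟩
  obtain ⟨k, hk, hc⟩ := QAmp.exists_rounds hΔ hΔ1 hδ hδ2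
  refine ⟨0, QAmp.fixedPoint n Δ k, ?_, ?_, fun C S σ ψ Φ hσ hψ hC hΦ => ?_⟩
  · rw [QAmp.copiesC_fixedPoint]; exact_mod_cast hk
  · rw [QAmp.copiesS_fixedPoint]; exact_mod_cast hk
  · rw [QAmp.tensor_ket0]
    exact QAmp.fixedPoint_obtains C S k hΔ hc hδ hσ hψ hC hΦ
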